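/- Let $\Bbbk$ be an algebraically closed field of characteristic zero and let $V$ be a $\Bbbk$-vector space with basis $x_0,x_1$; identify $S^dV$ with the space $\Bbbk[x_0,x_1]_d$ of binary forms of degree $d$. Let $f\in S^dV$ and let $0\le k<d$. Notation. - $\mathrm{R}_d(f)$ is the Waring rank: the least $r$ such that $f=\sum_{i=1}^r \ell_i^d$ for some $\ell_i\in V$. - $\nabla^kf$ is the set of all partial derivatives of order $k$ of $f$, and $\mathrm{R}_{\nabla}^{k}(f)$ is the least $r$ for which there are $\ell_1,\dots,\ell_r\in V$ such that every element of $\nabla^kf$ is a linear combination of $\ell_1^{d-k},\dots,\ell_r^{d-k}$. - For $\underline d=(d_1,\dots,d_m)\in\mathbb{N}^m$, $m\ge1$, with $d_1+\dots+d_m=d$, regard $S^dV$ as a subspace of $S^{\underline d}V=S^{d_1}V\otimes\cdots\otimes S^{d_m}V$ through polarization, the linear inclusion with $v^d\mapsto v^{d_1}\otimes\cdots\otimes v^{d_m}$. Then $\mathrm{R}_{\underline d}(f)$ is the least $r$ such that $f=\sum_{i=1}^r v_{i,1}^{d_1}\otimes\cdots\otimes v_{i,m}^{d_m}$ for some $v_{i,j}\in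 V$. - $\mathrm{cR}_{\underline d}(f)$ is the least degree of a $0$-dimensional closed subscheme $\mathbb{X}\subseteq(\mathbb{P}V)^{m}$ such that $f$ lies in the linear span of $\nu_{\underline d}(\mathbb{X})$, where $\nu_{\underline d}([v_1],\dots,[v_m])=[v_1^{d_1}\otimes\cdots\otimes v_m^{d_m}]$, and where the linear span of a subscheme is the common zero locus in $S^{\underline d}V$ of the linear forms in its ideal. Write $\mathrm{cR}_d$ for $\mathrm{cR}_{(d)}$. - $\mathrm{cR}_{\nabla}^{k}(f)$ is the least degree of a $0$-dimensional closed subscheme $\mathbb{X}\subseteq\mathbb{P}V$ such that $\nabla^kf$ is contained in the linear span of $\nu_{d-k}(\mathbb{X})$. (For $f=0$ all these ranks are $0$; the empty scheme is allowed, with degree $0$ and span $\{0\}$.) Proposition. We have $$\mathrm{R}_{\nabla}^{k}(f)=\min\{\mathrm{R}_d(f),\,d-k+1\}\qquad\text{and}\qquad \mathrm{cR}_{\nabla}^{k}(f)=\min\{\mathrm{cR}_d(f),\,d-k+1\}.$$ Consequently, for every $m\ge1$ and every $\underline d=(d_1,\dots,d_m)\in\mathbb{N}^m$ with $d_1+\dots+d_m=d$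 and $d_m=d-k$: (i) if $\mathrm{R}_d(f)\le d-k+1$, then $\mathrm{R}_d(f)=\mathrm{R}_{\underline d}(f)=\mathrm{R}_{\nabla}^{k}(f)$; (ii) if $\mathrm{cR}_d(f)\le d-k+1$, then $\mathrm{cR}_d(f)=\mathrm{cR}_{\underline d}(f)=\mathrm{cR}_{\nabla}^{k}(f)$. -/

import Mathlib

open MvPolynomial

noncomputable section

namespace GradientRank

variable {K : Type*} [Field K] {n m : ℕ}

/-! Throughout, `V = Kⁿ` with basis `x_0, …, x_{n-1}`, and `S^d V` is the space of homogeneous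
polynomials of degree `d` in `MvPolynomial (Fin n) K`. The coordinate ring of `ℙ V`, that is
`S^• V^*`, is also written `MvPolynomial (Fin n) K`, in the dual variables. -/

/-- The vector `v ∈ V`, seen as the linear form `∑ v_j x_j`. -/
def linForm (v : Fin n → K) : MvPolynomial (Fin n) K := ∑ j, C (v j) * X j

/-- The Waring rank `R_d(f)`: the least `r` such that `f` is a sum of `r` `d`-th powers of linear
forms. All ranks take values in `ℕ∞`, with value `⊤` if there is no decomposition at all. -/
def waringRank (d : ℕ) (f : MvPolynomial (Fin n) K) : ℕ∞ :=
  ⨅ (r : ℕ) (_ : ∃ v : Fin r → Fin n → K, f = ∑ i, linForm (v i) ^ d), (r : ℕ∞)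

/-- The set `∇^k f` of all partial derivatives of order `k` of `f`. -/
def nabla (k : ℕ) (f : MvPolynomial (Fin n) K) : Set (MvPolynomial (Fin n) K) :=
  {g | ∃ s : List (Fin n), s.length = k ∧ g = s.foldr (fun j h => pderiv j h) f}

/-- The `k`-th gradient rank of a form `f` of degree `d`. -/
def gradRank (d k : ℕ) (f : MvPolynomial (Fin n) K) : ℕ∞ :=
  ⨅ (r : ℕ) (_ : ∃ v : Fin r → Fin n → K, ∀ g ∈ nabla k f,
      ∃ c : Fin r → K, g = ∑ i, c i • linForm (v i) ^ (d - k)), (r : ℕ∞)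

/-! ### Zero-dimensional subschemes of projective space -/

/-- The dimension of the degree `i` component of `S^• V^* / I`, for a homogeneous ideal `I`. -/
def hilbertFunction (I : Ideal (MvPolynomial (Fin n) K)) (i : ℕ) : ℕ :=
  Module.finrank K
    ((homogeneousSubmodule (Fin n) K i).map (Ideal.Quotient.mkₐ K I).toLinearMap)

/-- `I` is the defining ideal of a zero-dimensional (possibly empty) closed subscheme of degree `r`
of `ℙ V`: it is homogeneous, saturated with respect to the irrelevant ideal, and its Hilbert
function is eventually equal to `r`. -/
structure IsZeroDimIdeal (I : Ideal (MvPolynomial (Fin n) K)) (r : ℕ) : Prop where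
  homogeneous : ∀ p ∈ I, ∀ i, homogeneousComponent i p ∈ I
  saturated : ∀ p, (∀ q ∈ Ideal.span (Set.range (X : Fin n → MvPolynomial (Fin n) K)),
    q * p ∈ I) → p ∈ I
  degree : ∃ N, ∀ i, N ≤ i → hilbertFunction I i = r

/-- The linear span in `S^d V` of the image under the `d`-th Veronese embedding of the scheme with
ideal `I`: the common zeros of the linear forms `L` on `S^d V` in the ideal of that image, that
is, such that the pullback `v ↦ L (v ^ d)` of `L` belongs to `I`. -/
def veroneseSpan (d : ℕ) (I : Ideal (MvPolynomial (Fin n) K)) : Set (MvPolynomial (Fin n) K) :=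
  {t | t.IsHomogeneous d ∧ ∀ L : MvPolynomial (Fin n) K →ₗ[K] K,
    (∃ φ ∈ I, ∀ v : Fin n → K, eval v φ = L (linForm v ^ d)) → L t = 0}

/-- The cactus rank `cR_d(f)` of a form `f` of degree `d`. -/
def cactusRank (d : ℕ) (f : MvPolynomial (Fin n) K) : ℕ∞ :=
  ⨅ (r : ℕ) (_ : ∃ I : Ideal (MvPolynomial (Fin n) K),
      IsZeroDimIdeal I r ∧ f ∈ veroneseSpan d I), (r : ℕ∞)

/-- The `k`-th gradient cactus rank of a form `f` of degree `d`. -/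
def gradCactusRank (d k : ℕ) (f : MvPolynomial (Fin n) K) : ℕ∞ :=
  ⨅ (r : ℕ) (_ : ∃ I : Ideal (MvPolynomial (Fin n) K),
      IsZeroDimIdeal I r ∧ nabla k f ⊆ veroneseSpan (d - k) I), (r : ℕ∞)

/-! ### Partially symmetric tensors

For `e = (e_0, …, e_{m-1})`, the space `S^{e_0} V ⊗ ⋯ ⊗ S^{e_{m-1}} V` is the space of
multihomogeneous polynomials of multidegree `e` in the variables `x_{i,j}`, `i < m`, `j < n`. -/

/-- The multigrading: `x_{i,j}` has multidegree the `i`-th unit vector. -/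
def multiDeg (m n : ℕ) : Fin m × Fin n → (Fin m → ℕ) := fun p => Pi.single p.1 1

/-- The rank-one tensor `v_0^{e_0} ⊗ ⋯ ⊗ v_{m-1}^{e_{m-1}}`. -/
def segreVeronese (e : Fin m → ℕ) (v : Fin m → Fin n → K) : MvPolynomial (Fin m × Fin n) K :=
  ∏ i, rename (fun j => (i, j)) (linForm (v i)) ^ e i

/-- The polarization, i.e. the inclusion of `S^d V` in `S^{e_0} V ⊗ ⋯ ⊗ S^{e_{m-1}} V`,
`d = ∑ e_i`: the component of multidegree `e` of `f (∑_i x_{i,·})`, with the normalization for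
which `v ^ d` is sent to `v^{e_0} ⊗ ⋯ ⊗ v^{e_{m-1}}`. -/
def polarization (e : Fin m → ℕ) (f : MvPolynomial (Fin n) K) : MvPolynomial (Fin m × Fin n) K :=
  ((∏ i, ((e i).factorial : K)) / ((∑ i, e i).factorial : K)) •
    weightedHomogeneousComponent (multiDeg m n) e (aeval (fun j => ∑ i : Fin m, X (i, j)) f)

/-- The partially symmetric rank of a tensor `t` of multidegree `e`. -/
def partSymRank (e : Fin m → ℕ) (t : MvPolynomial (Fin m × Fin n) K) : ℕ∞ :=
  ⨅ (r : ℕ) (_ : ∃ v : Fin r → Fin m → Fin n → K, t = ∑ i, segreVeronese e (v i)), (r : ℕ∞)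

/-- The dimension of the component of multidegree `a` of the quotient by a multihomogeneous ideal
`I` of the coordinate ring of `ℙ V × ⋯ × ℙ V`. -/
def multiHilbertFunction (I : Ideal (MvPolynomial (Fin m × Fin n) K)) (a : Fin m → ℕ) : ℕ :=
  Module.finrank K
    ((weightedHomogeneousSubmodule K (multiDeg m n) a).map (Ideal.Quotient.mkₐ K I).toLinearMap)

/-- `I` is the defining ideal of a zero-dimensional (possibly empty) closed subscheme of degree `r`
of the product of `m` copies of `ℙ V`: it is multihomogeneous, saturated with respect to the
irrelevant ideal `∏_i (x_{i,0}, …, x_{i,n-1})`, and its Hilbert function equals `r` in all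
multidegrees with large enough entries. -/
structure IsMultiZeroDimIdeal (I : Ideal (MvPolynomial (Fin m × Fin n) K)) (r : ℕ) : Prop where
  homogeneous : ∀ p ∈ I, ∀ a, weightedHomogeneousComponent (multiDeg m n) a p ∈ I
  saturated : ∀ p, (∀ q ∈ ∏ i : Fin m,
      Ideal.span (Set.range fun j : Fin n => (X (i, j) : MvPolynomial (Fin m × Fin n) K)),
    q * p ∈ I) → p ∈ I
  degree : ∃ N, ∀ a : Fin m → ℕ, (∀ i, N ≤ a i) → multiHilbertFunction I a = r

/-- The linear span of the image under the Segre-Veronese embedding of multidegree `e` of the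
scheme with ideal `I`: the common zeros of the linear forms `L` on the space of tensors whose
pullback `v ↦ L (v_0^{e_0} ⊗ ⋯ ⊗ v_{m-1}^{e_{m-1}})` belongs to `I`. -/
def segreVeroneseSpan (e : Fin m → ℕ) (I : Ideal (MvPolynomial (Fin m × Fin n) K)) :
    Set (MvPolynomial (Fin m × Fin n) K) :=
  {t | IsWeightedHomogeneous (multiDeg m n) t e ∧
    ∀ L : MvPolynomial (Fin m × Fin n) K →ₗ[K] K,
      (∃ φ ∈ I, ∀ v : Fin m → Fin n → K,
        eval (fun p => v p.1 p.2) φ = L (segreVeronese e v)) → L t = 0}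

/-- The cactus rank of a tensor `t` of multidegree `e` with respect to the Segre-Veronese
variety. -/
def partSymCactusRank (e : Fin m → ℕ) (t : MvPolynomial (Fin m × Fin n) K) : ℕ∞ :=
  ⨅ (r : ℕ) (_ : ∃ I : Ideal (MvPolynomial (Fin m × Fin n) K),
      IsMultiZeroDimIdeal I r ∧ t ∈ segreVeroneseSpan e I), (r : ℕ∞)

end GradientRank

end

open MvPolynomial

noncomputable section

namespace GradientRank

/-! ### The apolarity pairing -/

section Pairing

variable {K : Type*} [Field K] {σ : Type*} [Fintype σ]

/-! Everything is read off from apolarity. Multiplication by a variable is adjoint to the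
corresponding derivative (`apolar_X_mul`), and pairing a form of degree `d` with `v ^ d` is `d!`
times evaluation at `v` (`apolar_linear_pow`). Hence the span of the `d`-th powers of a set of
vectors, or of a scheme with ideal `I`, is the annihilator of the degree `d` part of the vanishing
ideal, and a form `P` kills all derivatives of order `k` of `f` exactly when its products with `k`
variables kill `f`.

The upper bounds are soft: what spans `f` spans its derivatives, and forms of degree `d - k` make up
a space of dimension `d - k + 1`. For the lower bounds, let `r ≤ d - k` points, or a scheme of
degree `r`, span the derivatives. On the projective line there is a form `φ` of degree at most `r`
in the ideal; for points it generates the forms vanishing on them, while a scheme may be replaced by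
the zero scheme of `φ`. Since `deg φ ≤ d - k`, each multiple of `φ` in degree `d` is a sum of
products of `k` variables with multiples of `φ` in degree `d - k`. Those kill the derivatives, so
the multiples of `φ` kill `f` (`apolar_eq_zero_of_nabla`) and the same points or scheme span `f`.

For the consequences, the partially symmetric ranks lie between the gradient ranks and the ranks of
`f`: derivatives of order `k` are contractions of the polarization in all factors but the last, and
decompositions of `f` embed diagonally. -/

/-- The apolarity pairing, for which the monomials are orthogonal and `⟨x^α, x^α⟩ = α!`. -/
def apolar : MvPolynomial σ K →ₗ[K] MvPolynomial σ K →ₗ[K] K :=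
  (basisMonomials σ K).constr K fun α => ((∏ i, (α i).factorial : ℕ) : K) • lcoeff K α

theorem apolar_monomial (α : σ →₀ ℕ) (c : K) (Q : MvPolynomial σ K) :
    apolar (monomial α c) Q = c * (((∏ i, (α i).factorial : ℕ) : K) * coeff α Q) := by
  have h : monomial α c = c • basisMonomials σ K α := by
    simp [coe_basisMonomials, smul_monomial]
  rw [h, map_smul, apolar, Module.Basis.constr_basis]
  simp [lcoeff_apply]

theorem apolar_X_mul (i : σ) (P Q : MvPolynomial σ K) :
    apolar (X i * P) Q = apolar P (pderiv i Q) := by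
  classical
  induction P using MvPolynomial.induction_on' with
  | add p q hp hq => simp [mul_add, hp, hq]
  | monomial α c =>
    rw [X, monomial_mul, one_mul, apolar_monomial, apolar_monomial, coeff_pderiv, add_comm]
    have h : ∏ j, ((α + Finsupp.single i 1 : σ →₀ ℕ) j).factorial = (α i + 1) * ∏ j, (α j).factorial := by
      rw [← Finset.mul_prod_erase _ _ (Finset.mem_univ i),
        ← Finset.mul_prod_erase _ (fun j => (α j).factorial) (Finset.mem_univ i), ← mul_assoc]
      congr 1
      · simp [Nat.factorial_succ]
      · refine Finset.prod_congr rfl fun j hj => ?_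
        simp [Finsupp.single_eq_of_ne (Finset.ne_of_mem_erase hj)]
    rw [h]
    push_cast
    ring

theorem apolar_list_mul (s : List σ) (P Q : MvPolynomial σ K) :
    apolar ((s.map X).prod * P) Q = apolar P (s.foldr (fun j h => pderiv j h) Q) := by
  induction s generalizing P with
  | nil => simp
  | cons a s ih =>
    rw [List.map_cons, List.prod_cons, List.foldr_cons, ← apolar_X_mul, ← ih]
    congr 2
    ring

theorem eq_of_apolar_eq [CharZero K] {d : ℕ} {t u : MvPolynomial σ K} (ht : t.IsHomogeneous d)
    (hu : u.IsHomogeneous d)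
    (h : ∀ P : MvPolynomial σ K, P.IsHomogeneous d → apolar P t = apolar P u) : t = u := by
  ext α
  by_cases hα : α.degree = d
  · have := h (monomial α 1) (isHomogeneous_monomial _ hα)
    rw [apolar_monomial, apolar_monomial, one_mul, one_mul] at this
    refine mul_left_cancel₀ ?_ this
    exact_mod_cast Finset.prod_ne_zero_iff.mpr fun i _ => Nat.factorial_ne_zero _
  · rw [ht.coeff_eq_zero hα, hu.coeff_eq_zero hα]

theorem factorial_mul_multinomial (α : σ →₀ ℕ) :
    (∏ i, (α i).factorial) * α.multinomial = α.degree.factorial := by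
  rw [← Finsupp.multinomial_of_support_subset (Finset.subset_univ α.support), Nat.multinomial_spec,
    Finsupp.degree_eq_sum]

theorem apolar_linear_pow (v : σ → K) {d : ℕ} {P : MvPolynomial σ K} (hP : P.IsHomogeneous d) :
    apolar P ((∑ i, C (v i) * X i) ^ d) = d.factorial * eval v P := by
  refine IsWeightedHomogeneous.induction_on (motive := fun P _ =>
    apolar P ((∑ i, C (v i) * X i) ^ d) = d.factorial * eval v P) ?_ ?_ ?_ hP
  · simp
  · intro p q _ _ hp hq
    simp [hp, hq, mul_add]
  · intro α c hα
    have hα' : α.degree = d := by rw [← hα, Finsupp.degree_eq_weight_one]; rfl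
    have h1 : α.sum (fun _ m => m) = d := by rw [← hα', Finsupp.degree]; rfl
    have h2 : (∑ i, C (v i) * X i : MvPolynomial σ K) = ∑ i, v i • X i := by
      simp [smul_eq_C_mul]
    rw [apolar_monomial, h2, coeff_linearCombination_X_pow_of_fintype, if_pos h1, eval_monomial,
      ← hα', ← factorial_mul_multinomial]
    push_cast
    ring

theorem isHomogeneous_linear_pow (v : σ → K) (d : ℕ) :
    ((∑ i, C (v i) * X i) ^ d : MvPolynomial σ K).IsHomogeneous d := by
  have h : (∑ i, C (v i) * X i : MvPolynomial σ K).IsHomogeneous 1 :=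
    IsHomogeneous.sum _ _ _ fun i _ => isHomogeneous_C_mul_X _ _
  simpa using h.pow d

/-- Every linear functional is, on the forms of degree `d`, the apolarity pairing with a form. -/
theorem exists_apolar_eq [CharZero K] (d : ℕ) (L : MvPolynomial σ K →ₗ[K] K) :
    ∃ P : MvPolynomial σ K, P.IsHomogeneous d ∧
      (∀ t : MvPolynomial σ K, t.IsHomogeneous d → apolar P t = d.factorial * L t) ∧
      ∀ v : σ → K, eval v P = L ((∑ i, C (v i) * X i) ^ d) := by
  classical
  -- The coefficients are forced by the multinomial expansion of `L ((∑ v_i x_i) ^ d)`.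
  let P : MvPolynomial σ K := ∑ α ∈ Finset.finsuppAntidiag Finset.univ d,
    monomial α ((α.multinomial : K) * L (monomial α 1))
  have hP : P.IsHomogeneous d := by
    refine IsHomogeneous.sum _ _ _ fun α hα => isHomogeneous_monomial _ ?_
    rw [Finset.mem_finsuppAntidiag] at hα
    rw [Finsupp.degree_eq_sum, hα.1]
  have hL : ∀ t : MvPolynomial σ K, t.IsHomogeneous d → apolar P t = d.factorial * L t := by
    intro t ht
    refine IsWeightedHomogeneous.induction_on (motive := fun t _ =>
      apolar P t = d.factorial * L t) ?_ ?_ ?_ ht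
    · simp
    · intro p q _ _ hp hq
      simp [hp, hq, mul_add]
    · intro β c hβ
      have hβ' : β.degree = d := by rw [← hβ, Finsupp.degree_eq_weight_one]; rfl
      have hc : monomial β c = c • (monomial β 1 : MvPolynomial σ K) := by simp [smul_monomial]
      rw [map_sum, LinearMap.sum_apply, Finset.sum_eq_single β]
      · rw [apolar_monomial, coeff_monomial, if_pos rfl, hc, map_smul, smul_eq_mul, ← hβ',
          ← factorial_mul_multinomial]
        push_cast
        ring
      · intro α _ hα
        rw [apolar_monomial, coeff_monomial, if_neg hα.symm]
        simp
      · intro h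
        refine absurd ?_ h
        rw [Finset.mem_finsuppAntidiag]
        exact ⟨by rw [← hβ', Finsupp.degree_eq_sum], Finset.subset_univ _⟩
  refine ⟨P, hP, hL, fun v => ?_⟩
  have h := hL _ (isHomogeneous_linear_pow v d)
  rw [apolar_linear_pow v hP] at h
  exact mul_left_cancel₀ (by exact_mod_cast Nat.factorial_ne_zero d) h

end Pairing

/-! ### Homogeneous polynomials, powers of linear forms and spans -/

section Homogeneous

variable {K : Type*} [Field K] {σ : Type*}

theorem weightedHomogeneousComponent_mul_left {M : Type*} [AddCancelCommMonoid M] {w : σ → M}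
    {a b : M} {q : MvPolynomial σ K} (hq : IsWeightedHomogeneous w q b) (p : MvPolynomial σ K) :
    weightedHomogeneousComponent w (b + a) (q * p) = q * weightedHomogeneousComponent w a p := by
  classical
  induction p using MvPolynomial.induction_on' with
  | add p q hp hq => simp [mul_add, hp, hq]
  | monomial α c =>
    have h : IsWeightedHomogeneous w (monomial α c) (Finsupp.weight w α) :=
      isWeightedHomogeneous_monomial w α c rfl
    rw [weightedHomogeneousComponent_of_mem ((mem_weightedHomogeneousSubmodule _ _ _ _).2 h),
      weightedHomogeneousComponent_of_mem ((mem_weightedHomogeneousSubmodule _ _ _ _).2 (hq.mul h))]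
    simp only [add_right_inj]
    split_ifs <;> simp

theorem eq_zero_or_exists_homogeneous_of_dvd {r d : ℕ} {φ P : MvPolynomial σ K}
    (hφ : φ.IsHomogeneous r) (hP : P.IsHomogeneous d) (h : φ ∣ P) :
    P = 0 ∨ r ≤ d ∧ ∃ ψ : MvPolynomial σ K, ψ.IsHomogeneous (d - r) ∧ P = φ * ψ := by
  by_cases hP0 : P = 0
  · exact Or.inl hP0
  obtain ⟨ψ, rfl⟩ := h
  have hφ0 : φ ≠ 0 := left_ne_zero_of_mul hP0
  have hψ0 : ψ ≠ 0 := right_ne_zero_of_mul hP0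
  have hrd : r ≤ d := by
    rw [← hφ.totalDegree hφ0, ← hP.totalDegree hP0, totalDegree_mul_of_isDomain hφ0 hψ0]
    exact Nat.le_add_right _ _
  refine Or.inr ⟨hrd, homogeneousComponent (d - r) ψ, homogeneousComponent_isHomogeneous _ _, ?_⟩
  have h1 := weightedHomogeneousComponent_mul_left (a := d - r) hφ ψ
  rw [Nat.add_sub_cancel' hrd] at h1
  exact (homogeneousComponent_eq_self hP).symm.trans h1

/-- The value `y` ranges over any algebra because the main use takes it in the quotient by `perpForm
v`. -/
theorem eval_smul_of_isHomogeneous {A : Type*} [CommRing A] [Algebra K A] {d : ℕ}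
    {P : MvPolynomial σ K} (hP : P.IsHomogeneous d) (v : σ → K) (y : A) :
    aeval (fun i => v i • y) P = eval v P • y ^ d := by
  refine IsWeightedHomogeneous.induction_on (motive := fun P _ =>
    aeval (fun i => v i • y) P = eval v P • y ^ d) ?_ ?_ ?_ hP
  · simp
  · intro p q _ _ hp hq
    simp [hp, hq, add_smul]
  · intro α c hα
    have hα' : ∑ i ∈ α.support, α i = d := by
      rw [← hα, ← Finsupp.degree_apply, Finsupp.degree_eq_weight_one]; rfl
    simp only [aeval_monomial, eval_monomial, Finsupp.prod, Algebra.smul_def, map_mul, mul_assoc,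
      mul_pow, Finset.prod_mul_distrib, Finset.prod_pow_eq_pow_sum, hα', map_prod, map_pow]

theorem isHomogeneous_list_prod_X (l : List σ) :
    (l.map (X : σ → MvPolynomial σ K)).prod.IsHomogeneous l.length := by
  induction l with
  | nil => simpa using isHomogeneous_one σ K
  | cons a l ih =>
    rw [List.map_cons, List.prod_cons, List.length_cons, add_comm]
    exact (isHomogeneous_X K a).mul ih

/-- On forms of degree `k + u`, it suffices to test a linear property on products of `k` variables
and a form of degree `u`. -/
theorem isHomogeneous_add_induction {k u : ℕ} {p : MvPolynomial σ K → Prop} (zero : p 0)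
    (add : ∀ P Q, p P → p Q → p (P + Q))
    (mul : ∀ (s : List σ) (Q : MvPolynomial σ K), s.length = k → Q.IsHomogeneous u →
      p ((s.map X).prod * Q))
    {P : MvPolynomial σ K} (hP : P.IsHomogeneous (k + u)) : p P := by
  classical
  refine IsWeightedHomogeneous.induction_on (motive := fun P _ => p P) zero
    (fun _ _ _ _ h₁ h₂ => add _ _ h₁ h₂) ?_ hP
  intro α c hα
  have hα' : α.degree = k + u := by rw [← hα, Finsupp.degree_eq_weight_one]; rfl
  have hprod : ∀ l : List σ, (l.map (X : σ → MvPolynomial σ K)).prod =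
      monomial (Multiset.toFinsupp (l : Multiset σ)) 1 := by
    intro l
    induction l with
    | nil => simp
    | cons a l ih =>
      rw [List.map_cons, List.prod_cons, ih, ← Multiset.cons_coe, ← Multiset.singleton_add,
        map_add, Multiset.toFinsupp_singleton, X, monomial_mul, one_mul]
  let l := (Finsupp.toMultiset α).toList
  have hl : l.length = k + u := by
    rw [Multiset.length_toList, Finsupp.card_toMultiset, ← hα']
    rfl
  have hαl : (l.map (X : σ → MvPolynomial σ K)).prod = monomial α 1 := by
    rw [hprod, Multiset.coe_toList, Finsupp.toMultiset_toFinsupp]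
  have hsplit : (monomial α c : MvPolynomial σ K) =
      ((l.take k).map X).prod * (C c * ((l.drop k).map X).prod) := by
    rw [mul_left_comm, ← List.prod_append, ← List.map_append, List.take_append_drop, hαl,
      C_mul_monomial, mul_one]
  rw [hsplit]
  refine mul _ _ (by simp [hl]) (IsHomogeneous.C_mul ?_ c)
  simpa [hl] using isHomogeneous_list_prod_X (K := K) (l.drop k)

theorem isHomogeneous_list_foldr_pderiv {d : ℕ} {f : MvPolynomial σ K} (hf : f.IsHomogeneous d)
    (s : List σ) : (s.foldr (fun j h => pderiv j h) f).IsHomogeneous (d - s.length) := by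
  induction s with
  | nil => simpa using hf
  | cons a s ih =>
    rw [List.foldr_cons, List.length_cons, ← Nat.sub_sub]
    exact ih.pderiv

end Homogeneous

/-! ### Spans of powers and of schemes as annihilators. -/

section Veronese

variable {K : Type*} [Field K] [CharZero K] {n : ℕ}

/-- Duality: a functional separating `t` from the span is pairing with a form, and killing the
powers means that this form vanishes on `S`. -/
theorem mem_span_pow_of_apolar {d : ℕ} {t : MvPolynomial (Fin n) K} (ht : t.IsHomogeneous d)
    (S : Set (Fin n → K))
    (h : ∀ P : MvPolynomial (Fin n) K, P.IsHomogeneous d → (∀ v ∈ S, eval v P = 0) →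
      apolar P t = 0) :
    t ∈ Submodule.span K ((fun v => linForm v ^ d) '' S) := by
  by_contra hn
  obtain ⟨L, hLt, hL⟩ := Submodule.exists_le_ker_of_notMem hn
  obtain ⟨P, hP, hPL, hPe⟩ := exists_apolar_eq d L
  have h0 := h P hP fun v hv => by
    rw [hPe]
    exact hL (Submodule.subset_span ⟨v, hv, rfl⟩)
  rw [hPL t ht] at h0
  exact (mul_ne_zero (by exact_mod_cast Nat.factorial_ne_zero d) hLt) h0

theorem span_pow_linForm (d : ℕ) :
    Submodule.span K (Set.range fun v : Fin n → K => linForm v ^ d) =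
      homogeneousSubmodule (Fin n) K d := by
  apply le_antisymm
  · rw [Submodule.span_le]
    rintro _ ⟨v, rfl⟩
    exact isHomogeneous_linear_pow v d
  · intro t ht
    rw [← Set.image_univ]
    refine mem_span_pow_of_apolar ht _ fun P hP h => ?_
    rw [hP.eq_zero_of_forall_eval_eq_zero fun v => h v trivial]
    simp

theorem mem_veroneseSpan_iff {d : ℕ} {I : Ideal (MvPolynomial (Fin n) K)}
    {t : MvPolynomial (Fin n) K} :
    t ∈ veroneseSpan d I ↔ t.IsHomogeneous d ∧
      ∀ P ∈ I, P.IsHomogeneous d → apolar P t = 0 := by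
  have hd : (d.factorial : K) ≠ 0 := by exact_mod_cast Nat.factorial_ne_zero d
  refine and_congr_right fun ht => ⟨fun h P hPI hP => ?_, fun h L ⟨φ, hφ, hφL⟩ => ?_⟩
  · have := h ((d.factorial : K)⁻¹ • apolar P) ⟨P, hPI, fun v => ?_⟩
    · simpa [hd] using this
    · rw [LinearMap.smul_apply, linForm, apolar_linear_pow v hP, smul_eq_mul,
        inv_mul_cancel_left₀ hd]
  · obtain ⟨P, hP, hPL, hPe⟩ := exists_apolar_eq d L
    -- The field is infinite, so `φ` is determined by its values; in particular it is homogeneous.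
    have hφP : φ = P := MvPolynomial.funext fun v => (hφL v).trans (hPe v).symm
    have h0 := h φ hφ (hφP ▸ hP)
    rw [hφP, hPL t ht] at h0
    exact (mul_eq_zero.mp h0).resolve_left hd

end Veronese

/-! ### Binary forms -/

section Binary

variable {K : Type*} [Field K]

theorem finrank_homogeneousSubmodule_fin_two (i : ℕ) :
    Module.finrank K (homogeneousSubmodule (Fin 2) K i) = i + 1 := by
  have h : {α : Fin 2 →₀ ℕ | α.degree = i} =
      (Finset.finsuppAntidiag (Finset.univ : Finset (Fin 2)) i : Set (Fin 2 →₀ ℕ)) := by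
    ext α
    simp [Finsupp.degree_eq_sum]
  rw [homogeneousSubmodule_eq_finsupp_supported]
  change Module.finrank K (restrictSupport K {α : Fin 2 →₀ ℕ | α.degree = i}) = i + 1
  rw [Module.finrank_eq_nat_card_basis (basisRestrictSupport K {α : Fin 2 →₀ ℕ | α.degree = i}), h]
  rw [SetLike.coe_sort_coe, Nat.card_eq_fintype_card, Fintype.card_coe,
    Finset.card_finsuppAntidiag_nat_eq_choose]
  simp [add_comm]

instance finite_homogeneousSubmodule {σ : Type*} [Finite σ] (i : ℕ) :
    Module.Finite K (homogeneousSubmodule σ K i) :=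
  Module.Finite.iff_fg.mpr (homogeneousSubmodule_fg σ K i)

/-- The linear form vanishing at `v`. -/
def perpForm (v : Fin 2 → K) : MvPolynomial (Fin 2) K := C (v 1) * X 0 - C (v 0) * X 1

theorem perpForm_isHomogeneous (v : Fin 2 → K) : (perpForm v).IsHomogeneous 1 :=
  (isHomogeneous_C_mul_X _ _).sub (isHomogeneous_C_mul_X _ _)

/-- Modulo `perpForm v` the variables become `v i • y` for a single `y`, so `P` becomes `P(v) y ^ d
= 0`. -/
theorem perpForm_dvd {d : ℕ} {P : MvPolynomial (Fin 2) K} (hP : P.IsHomogeneous d)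
    {v : Fin 2 → K} (hv : v ≠ 0) (h : eval v P = 0) : perpForm v ∣ P := by
  rw [← Ideal.mem_span_singleton, ← Ideal.Quotient.eq_zero_iff_mem]
  set I := Ideal.span {perpForm v}
  let π := Ideal.Quotient.mkₐ K I
  have hrel : v 1 • π (X 0) = v 0 • π (X 1) := by
    rw [← sub_eq_zero, ← map_smul, ← map_smul, ← map_sub]
    refine Ideal.Quotient.eq_zero_iff_mem.mpr ?_
    rw [smul_eq_C_mul, smul_eq_C_mul]
    exact Ideal.mem_span_singleton_self _
  have hy : ∃ y, ∀ i, π (X i) = v i • y := by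
    by_cases h0 : v 0 = 0
    · have h1 : v 1 ≠ 0 := fun h1 => hv (by ext i; fin_cases i <;> simp [h0, h1])
      refine ⟨(v 1)⁻¹ • π (X 1), fun i => ?_⟩
      fin_cases i
      · have : π (X 0) = 0 := by
          have := congrArg ((v 1)⁻¹ • ·) hrel
          simpa [smul_smul, h1, h0] using this
        simp [this, h0]
      · simp [smul_smul, h1]
    · refine ⟨(v 0)⁻¹ • π (X 0), fun i => ?_⟩
      fin_cases i
      · simp [smul_smul, h0]
      · have := congrArg ((v 0)⁻¹ • ·) hrel
        simp only [smul_smul] at this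
        simp [smul_smul, mul_comm (v 1), this, h0]
  obtain ⟨y, hy⟩ := hy
  have h1 : π P = aeval (fun i => v i • y) P := by
    rw [← funext hy]
    exact (congrArg (fun g : MvPolynomial (Fin 2) K →ₐ[K] _ => g P)
      (MvPolynomial.aeval_unique π))
  change π P = 0
  rw [h1, eval_smul_of_isHomogeneous hP, h, zero_smul]

/-- Finitely many points of the plane have a form of degree at most their number that generates,
among the forms, those that vanish at these points. -/
theorem exists_form_generating_vanishing (r : ℕ) (v : Fin r → Fin 2 → K) :
    ∃ (r' : ℕ) (φ : MvPolynomial (Fin 2) K), r' ≤ r ∧ φ.IsHomogeneous r' ∧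
      (∀ i, v i ≠ 0 → eval (v i) φ = 0) ∧
      ∀ (d : ℕ) (P : MvPolynomial (Fin 2) K), P.IsHomogeneous d →
        (∀ i, eval (v i) P = 0) → φ ∣ P := by
  induction r with
  | zero => exact ⟨0, 1, le_rfl, isHomogeneous_one _ _, fun i => i.elim0, fun _ _ _ _ => one_dvd _⟩
  | succ r ih =>
    obtain ⟨r', φ, hr, hφ, hv, hdvd⟩ := ih fun i => v i.castSucc
    -- A zero vector or a point where `φ` already vanishes costs no degree. Zero vectors are exempt
    -- from the vanishing of `φ`, which may be the constant `1`.
    by_cases hlast : v (Fin.last r) = 0 ∨ eval (v (Fin.last r)) φ = 0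
    · refine ⟨r', φ, hr.trans (Nat.le_succ r), hφ, ?_, fun d P hP h =>
        hdvd d P hP fun i => h i.castSucc⟩
      refine Fin.lastCases (fun h => hlast.resolve_left h) fun i => hv i
    · push Not at hlast
      refine ⟨r' + 1, φ * perpForm (v (Fin.last r)), Nat.succ_le_succ hr,
        hφ.mul (perpForm_isHomogeneous _), ?_, fun d P hP h => ?_⟩
      · refine Fin.lastCases (fun _ => ?_) fun i hi => ?_
        · simp [perpForm, mul_comm]
        · rw [map_mul, hv i hi, zero_mul]
      · rcases eq_zero_or_exists_homogeneous_of_dvd hφ hP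
          (hdvd d P hP fun i => h i.castSucc) with rfl | ⟨_, ψ, hψ, rfl⟩
        · exact dvd_zero _
        · have h0 := h (Fin.last r)
          rw [map_mul] at h0
          exact mul_dvd_mul_left φ
            (perpForm_dvd hψ hlast.1 ((mul_eq_zero.mp h0).resolve_left hlast.2))

/-- This is saturation of a principal ideal, by coprimality of the two variables: the cofactors
satisfy `X 1 * a = X 0 * b`, so `X 0` divides `a`. -/
theorem dvd_of_dvd_X_mul {φ p : MvPolynomial (Fin 2) K} (hφ : φ ≠ 0) (h0 : φ ∣ X 0 * p)
    (h1 : φ ∣ X 1 * p) : φ ∣ p := by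
  obtain ⟨a, ha⟩ := h0
  obtain ⟨b, hb⟩ := h1
  have hab : X 1 * a = X 0 * b := by
    apply mul_left_cancel₀ hφ
    rw [mul_left_comm, ← ha, mul_left_comm φ, ← hb]
    ring
  have hX : (X 0 : MvPolynomial (Fin 2) K) ∣ X 1 * a := ⟨b, hab⟩
  have hprime : Prime (X 0 : MvPolynomial (Fin 2) K) := X_prime
  rcases hprime.dvd_or_dvd hX with h | ⟨c, rfl⟩
  · exact absurd (X_dvd_X.mp h) (by simp)
  · refine ⟨c, mul_left_cancel₀ hprime.ne_zero ?_⟩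
    rw [ha]
    ring

theorem isZeroDimIdeal_span_singleton {r : ℕ} {φ : MvPolynomial (Fin 2) K}
    (hφ : φ.IsHomogeneous r) (hφ0 : φ ≠ 0) : IsZeroDimIdeal (Ideal.span {φ}) r where
  homogeneous p hp i := by
    let _ : GradedAlgebra (homogeneousSubmodule (Fin 2) K) := MvPolynomial.gradedAlgebra
    refine homogeneousComponent_mem_of_mem (Ideal.homogeneous_span _ _ ?_) hp i
    rintro _ rfl
    exact ⟨r, hφ⟩
  saturated p hp := by
    have h : ∀ j, φ ∣ X j * p := fun j =>
      Ideal.mem_span_singleton.mp (hp _ (Ideal.subset_span ⟨j, rfl⟩))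
    exact Ideal.mem_span_singleton.mpr (dvd_of_dvd_X_mul hφ0 (h 0) (h 1))
  degree := by
    refine ⟨r, fun i hi => ?_⟩
    let g := (Ideal.Quotient.mkₐ K (Ideal.span {φ})).toLinearMap ∘ₗ
      (homogeneousSubmodule (Fin 2) K i).subtype
    let m : homogeneousSubmodule (Fin 2) K (i - r) →ₗ[K] homogeneousSubmodule (Fin 2) K i :=
      LinearMap.codRestrict _ (LinearMap.mulLeft K φ ∘ₗ Submodule.subtype _) fun ψ => by
        have := hφ.mul ((mem_homogeneousSubmodule _ _).mp ψ.2)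
        rwa [Nat.add_sub_cancel' hi] at this
    have hm : Function.Injective m := fun a b hab =>
      Subtype.ext (mul_left_cancel₀ hφ0 (congrArg Subtype.val hab))
    have hker : LinearMap.ker g = LinearMap.range m := by
      ext ⟨P, hP⟩
      have h1 : (⟨P, hP⟩ : homogeneousSubmodule (Fin 2) K i) ∈ LinearMap.ker g ↔ φ ∣ P := by
        rw [← Ideal.mem_span_singleton, ← Ideal.Quotient.eq_zero_iff_mem]
        rfl
      rw [h1]
      constructor
      · intro h
        rcases eq_zero_or_exists_homogeneous_of_dvd hφ hP h with rfl | ⟨_, ψ, hψ, rfl⟩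
        · exact ⟨0, map_zero m⟩
        · exact ⟨⟨ψ, hψ⟩, rfl⟩
      · rintro ⟨ψ, hψ⟩
        exact ⟨ψ, (congrArg Subtype.val hψ).symm⟩
    have hrange : LinearMap.range g = (homogeneousSubmodule (Fin 2) K i).map
        (Ideal.Quotient.mkₐ K (Ideal.span {φ})).toLinearMap := by
      rw [LinearMap.range_comp, Submodule.range_subtype]
    -- The kernel is a copy of the forms of degree `i - r`, so the rank is `(i + 1) - (i - r + 1) =
    -- r`.
    have hrk := LinearMap.finrank_range_add_finrank_ker g
    rw [hker, LinearMap.finrank_range_of_inj hm, finrank_homogeneousSubmodule_fin_two,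
      finrank_homogeneousSubmodule_fin_two, hrange] at hrk
    change Module.finrank K _ = r
    omega

end Binary

/-! ### Gradient ranks and ranks of binary forms -/

section BinaryRanks

variable {K : Type*} [Field K] {n : ℕ}

theorem pderiv_linForm (v : Fin n → K) (j : Fin n) : pderiv j (linForm v) = C (v j) := by
  classical
  simp [linForm, map_sum, pderiv_X, Pi.single_apply]

theorem foldr_pderiv_sum_pow {r d : ℕ} (v : Fin r → Fin n → K) (s : List (Fin n)) :
    ∃ c : Fin r → K, s.foldr (fun j h => pderiv j h) (∑ i, linForm (v i) ^ d) =
      ∑ i, c i • linForm (v i) ^ (d - s.length) := by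
  induction s with
  | nil => exact ⟨1, by simp⟩
  | cons a s ih =>
    obtain ⟨c, hc⟩ := ih
    refine ⟨fun i => c i * ((d - s.length : ℕ) * v i a), ?_⟩
    rw [List.foldr_cons, hc, map_sum]
    refine Finset.sum_congr rfl fun i _ => ?_
    rw [Derivation.map_smul, pderiv_pow, pderiv_linForm, List.length_cons, ← Nat.sub_sub,
      smul_eq_C_mul, smul_eq_C_mul, C_mul, C_mul, map_natCast]
    ring

theorem gradRank_le_waringRank (d k : ℕ) (f : MvPolynomial (Fin n) K) :
    gradRank d k f ≤ waringRank d f := by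
  refine le_iInf₂ fun r ⟨v, hv⟩ => iInf₂_le_of_le r ⟨v, ?_⟩ le_rfl
  rintro g ⟨s, rfl, rfl⟩
  rw [hv]
  exact foldr_pderiv_sum_pow v s

theorem nabla_isHomogeneous {d k : ℕ} {f g : MvPolynomial (Fin n) K} (hf : f.IsHomogeneous d)
    (hg : g ∈ nabla k f) : g.IsHomogeneous (d - k) := by
  obtain ⟨s, rfl, rfl⟩ := hg
  exact isHomogeneous_list_foldr_pderiv hf s

/-- A multiple of a form `φ` of degree at most `d - k` is apolar to `f` as soon as the multiples of
`φ` are apolar to the derivatives of order `k` of `f`. -/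
theorem apolar_eq_zero_of_nabla {d k r : ℕ} (hk : k < d) (hr : r ≤ d - k)
    {f φ P : MvPolynomial (Fin 2) K} (hφ : φ.IsHomogeneous r) (hP : P.IsHomogeneous d)
    (hφP : φ ∣ P)
    (h : ∀ g ∈ nabla k f, ∀ Q : MvPolynomial (Fin 2) K, Q.IsHomogeneous (d - k) → φ ∣ Q →
      apolar Q g = 0) :
    apolar P f = 0 := by
  rcases eq_zero_or_exists_homogeneous_of_dvd hφ hP hφP with rfl | ⟨_, ψ, hψ, rfl⟩
  · simp
  -- Here `r ≤ d - k` is essential: `k` variables can be split off the cofactor while `φ` stays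
  -- intact.
  rw [show d - r = k + (d - k - r) by omega] at hψ
  refine isHomogeneous_add_induction (p := fun ψ => apolar (φ * ψ) f = 0) (by simp)
    (fun A B hA hB => by rw [mul_add, map_add, LinearMap.add_apply, hA, hB, add_zero]) ?_ hψ
  intro s Q hs hQ
  rw [mul_left_comm, apolar_list_mul]
  refine h _ ⟨s, hs, rfl⟩ _ ?_ (dvd_mul_right _ _)
  have := hφ.mul hQ
  rwa [Nat.add_sub_cancel' hr] at this

/-- A linear map from binary forms of degree `r` to a space of dimension `r` is not injective. -/
theorem exists_form_map_mem {σ : Type*} {r : ℕ} {I : Ideal (MvPolynomial σ K)}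
    (U : Submodule K (MvPolynomial σ K)) [Module.Finite K U]
    (hU : Module.finrank K (U.map (Ideal.Quotient.mkₐ K I).toLinearMap) = r)
    (T : MvPolynomial (Fin 2) K →ₗ[K] MvPolynomial σ K)
    (hT : ∀ φ : MvPolynomial (Fin 2) K, φ.IsHomogeneous r → T φ ∈ U) :
    ∃ φ : MvPolynomial (Fin 2) K, φ.IsHomogeneous r ∧ φ ≠ 0 ∧ T φ ∈ I := by
  by_contra! hcon
  let g : homogeneousSubmodule (Fin 2) K r →ₗ[K] U.map (Ideal.Quotient.mkₐ K I).toLinearMap :=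
    LinearMap.codRestrict _ ((Ideal.Quotient.mkₐ K I).toLinearMap ∘ₗ T ∘ₗ Submodule.subtype _)
      fun φ => ⟨T φ, hT φ φ.2, rfl⟩
  have hg : Function.Injective g := by
    rw [← LinearMap.ker_eq_bot, LinearMap.ker_eq_bot']
    rintro ⟨φ, hφ⟩ h0
    by_contra hne
    exact hcon φ hφ (fun h => hne (Subtype.ext h))
      (Ideal.Quotient.eq_zero_iff_mem.mp (congrArg Subtype.val h0))
  have := LinearMap.finrank_le_finrank_of_injective hg
  rw [finrank_homogeneousSubmodule_fin_two, hU] at this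
  omega

variable [CharZero K]

/-- The powers span a space of dimension `s + 1`, so a basis can be extracted from them. -/
theorem exists_pow_span_homogeneousSubmodule (s : ℕ) :
    ∃ v : Fin (s + 1) → Fin 2 → K, ∀ g : MvPolynomial (Fin 2) K, g.IsHomogeneous s →
      ∃ c : Fin (s + 1) → K, g = ∑ i, c i • linForm (v i) ^ s := by
  have hfin : Module.Finite K
      (Submodule.span K (Set.range fun v : Fin 2 → K => linForm v ^ s)) := by
    rw [span_pow_linForm]
    infer_instance
  obtain ⟨b, hb, hspan, -⟩ := Submodule.exists_fun_fin_finrank_span_eq K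
    (Set.range fun v : Fin 2 → K => linForm v ^ s)
  have hrank : Module.finrank K (Submodule.span K (Set.range fun v : Fin 2 → K => linForm v ^ s)) =
      s + 1 := by
    rw [span_pow_linForm, finrank_homogeneousSubmodule_fin_two]
  choose v hv using hb
  refine ⟨fun i => v (Fin.cast hrank.symm i), fun g hg => ?_⟩
  have hg' : g ∈ Submodule.span K (Set.range b) := by
    rw [hspan, span_pow_linForm]
    exact hg
  obtain ⟨c, rfl⟩ := (Submodule.mem_span_range_iff_exists_fun K).mp hg'
  refine ⟨fun i => c (Fin.cast hrank.symm i), ?_⟩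
  rw [← Equiv.sum_comp (finCongr hrank.symm)]
  refine Finset.sum_congr rfl fun i _ => ?_
  simp only [finCongr_apply, ← hv]

theorem gradRank_le_succ {d k : ℕ} {f : MvPolynomial (Fin 2) K} (hf : f.IsHomogeneous d) :
    gradRank d k f ≤ ((d - k + 1 : ℕ) : ℕ∞) := by
  obtain ⟨v, hv⟩ := exists_pow_span_homogeneousSubmodule (K := K) (d - k)
  exact iInf₂_le_of_le (d - k + 1) ⟨v, fun g hg => hv g (nabla_isHomogeneous hf hg)⟩ le_rfl

theorem min_le_gradRank [IsAlgClosed K] {d k : ℕ} (hk : k < d) {f : MvPolynomial (Fin 2) K}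
    (hf : f.IsHomogeneous d) :
    min (waringRank d f) ((d - k + 1 : ℕ) : ℕ∞) ≤ gradRank d k f := by
  refine le_iInf₂ fun r ⟨v, hv⟩ => ?_
  rcases Nat.lt_or_ge (d - k) r with hr | hr
  · exact (min_le_right _ _).trans (by exact_mod_cast hr)
  refine (min_le_left _ _).trans ?_
  obtain ⟨r', φ, hr', hφ, hφv, hdvd⟩ := exists_form_generating_vanishing r v
  have hf' : f ∈ Submodule.span K ((fun v => linForm v ^ d) '' Set.range v) := by
    refine mem_span_pow_of_apolar hf _ fun P hP hPv => ?_
    refine apolar_eq_zero_of_nabla hk (hr'.trans hr) hφ hP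
      (hdvd d P hP fun i => hPv _ ⟨i, rfl⟩) ?_
    rintro g hg _ hQ ⟨Q, rfl⟩
    obtain ⟨c, rfl⟩ := hv g hg
    rw [map_sum]
    refine Finset.sum_eq_zero fun i _ => ?_
    rw [map_smul, linForm, apolar_linear_pow _ hQ]
    -- `φ` need not vanish at a zero vector, but `φ * Q` does, having degree `d - k > 0`.
    by_cases hi : v i = 0
    · have h0 : eval (v i) (φ * Q) = 0 := by
        have := eval_smul_of_isHomogeneous hQ (v i) (0 : K)
        rw [zero_pow (by omega)] at this
        simpa [hi, aeval_def, eval₂_eq_eval_map, Pi.zero_def] using this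
      rw [h0, mul_zero, smul_zero]
    · rw [map_mul, hφv i hi, zero_mul, mul_zero, smul_zero]
  rw [← Set.range_comp] at hf'
  obtain ⟨c, hc⟩ := (Submodule.mem_span_range_iff_exists_fun K).mp hf'
  -- Coefficients are absorbed into the linear forms by taking `d`-th roots.
  choose z hz using fun i => IsAlgClosed.exists_pow_nat_eq (c i) (Nat.zero_lt_of_lt hk)
  refine iInf₂_le_of_le r ⟨fun i => z i • v i, ?_⟩ le_rfl
  rw [← hc]
  refine Finset.sum_congr rfl fun i _ => ?_
  have : linForm (z i • v i) = z i • linForm (v i) := by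
    simp [linForm, smul_eq_C_mul, mul_assoc]
  rw [this, smul_pow, hz]
  rfl

/-! ### Cactus ranks and schemes on the projective line. -/

theorem gradCactusRank_le_cactusRank {d k : ℕ} (hk : k < d) {f : MvPolynomial (Fin n) K} :
    gradCactusRank d k f ≤ cactusRank d f := by
  refine le_iInf₂ fun r ⟨I, hI, hfI⟩ => iInf₂_le_of_le r ⟨I, hI, ?_⟩ le_rfl
  rw [mem_veroneseSpan_iff] at hfI
  intro g hg
  refine mem_veroneseSpan_iff.mpr ⟨nabla_isHomogeneous hfI.1 hg, fun P hPI hP => ?_⟩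
  obtain ⟨s, rfl, rfl⟩ := hg
  rw [← apolar_list_mul]
  refine hfI.2 _ (I.mul_mem_left _ hPI) ?_
  have := (isHomogeneous_list_prod_X (K := K) s).mul hP
  rwa [Nat.add_sub_cancel' hk.le] at this

theorem gradCactusRank_le_of_form {d k r : ℕ} {f φ : MvPolynomial (Fin 2) K}
    (hf : f.IsHomogeneous d) (hφ : φ.IsHomogeneous r) (hφ0 : φ ≠ 0)
    (h : ∀ g ∈ nabla k f, ∀ Q : MvPolynomial (Fin 2) K, Q.IsHomogeneous (d - k) → φ ∣ Q →
      apolar Q g = 0) :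
    gradCactusRank d k f ≤ r :=
  iInf₂_le_of_le r ⟨Ideal.span {φ}, isZeroDimIdeal_span_singleton hφ hφ0, fun g hg =>
    mem_veroneseSpan_iff.mpr ⟨nabla_isHomogeneous hf hg, fun P hPI hP =>
      h g hg P hP (Ideal.mem_span_singleton.mp hPI)⟩⟩ le_rfl

theorem gradCactusRank_le_succ {d k : ℕ} {f : MvPolynomial (Fin 2) K} (hf : f.IsHomogeneous d) :
    gradCactusRank d k f ≤ ((d - k + 1 : ℕ) : ℕ∞) := by
  -- A form of degree `d - k + 1` has no nonzero multiple in degree `d - k`, so the apolarity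
  -- condition is empty.
  refine gradCactusRank_le_of_form hf (isHomogeneous_X_pow 0 (d - k + 1))
    (pow_ne_zero _ (X_ne_zero _)) fun g _ Q hQ hdvd => ?_
  rcases eq_zero_or_exists_homogeneous_of_dvd (isHomogeneous_X_pow 0 _) hQ hdvd with rfl | ⟨h, _⟩
  · simp
  · omega

/-- If a subspace of a noetherian algebra over an infinite field contains enough elements to detect
membership in an ideal, then some element of it is a nonzerodivisor modulo this ideal. -/
theorem exists_mem_regular {A : Type*} [CommRing A] [Algebra K A] [IsNoetherianRing A]
    (I : Ideal A) (W : Submodule K A) (h : ∀ p, (∀ w ∈ W, w * p ∈ I) → p ∈ I) :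
    ∃ w ∈ W, ∀ p, w * p ∈ I → p ∈ I := by
  by_contra! hcon
  have hfin : (associatedPrimes A (A ⧸ I)).Finite := associatedPrimes.finite A (A ⧸ I)
  have hcover : ∀ w : W, ∃ p : associatedPrimes A (A ⧸ I), (w : A) ∈ p.1 := by
    intro w
    obtain ⟨p, hp, hpI⟩ := hcon w w.2
    have hw : (w : A) ∈ ⋃ p ∈ associatedPrimes A (A ⧸ I), (p : Set A) := by
      rw [biUnion_associatedPrimes_eq_zero_divisors]
      exact ⟨Ideal.Quotient.mk I p, fun h0 => hpI (Ideal.Quotient.eq_zero_iff_mem.mp h0),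
        Ideal.Quotient.eq_zero_iff_mem.mpr hp⟩
    simp only [Set.mem_iUnion] at hw
    obtain ⟨p, hp, hwp⟩ := hw
    exact ⟨⟨p, hp⟩, hwp⟩
  have : Finite (associatedPrimes A (A ⧸ I)) := hfin
  -- Over an infinite field a space is not a finite union of proper subspaces, so `W` lies in one
  -- associated prime, the annihilator of a class `x`; then `h` forces `x ∈ I`.
  obtain ⟨⟨p, hp⟩, hpW⟩ := Subspace.exists_eq_top_of_iUnion_eq_univ
    (p := fun p : associatedPrimes A (A ⧸ I) => (p.1.restrictScalars K).comap W.subtype) (by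
      rw [Set.eq_univ_iff_forall]
      intro w
      obtain ⟨p, hwp⟩ := hcover w
      exact Set.mem_iUnion.mpr ⟨p, hwp⟩)
  obtain ⟨hprime, x, hx⟩ := isAssociatedPrime_iff.mp hp
  obtain ⟨x, rfl⟩ := Ideal.Quotient.mk_surjective x
  have hmem : ∀ a, a ∈ p ↔ a * x ∈ I := by
    intro a
    rw [hx, Submodule.mem_colon_singleton, Submodule.mem_bot, ← Ideal.Quotient.eq_zero_iff_mem]
    rfl
  have hxI : x ∈ I := h x fun w hw => (hmem w).mp (by
    have : (⟨w, hw⟩ : W) ∈ (⊤ : Submodule K W) := trivial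
    rw [← hpW] at this
    exact this)
  exact hprime.ne_top ((Ideal.eq_top_iff_one p).mpr ((hmem 1).mpr (by simpa using hxI)))

/-- Multiplication by `l ^ N`, for a linear nonzerodivisor `l` modulo `I`, sends the `r + 1`
dimensions of forms of degree `r` to a quotient of dimension `r`; an element of the kernel lies in
`I`. -/
theorem IsZeroDimIdeal.exists_form_mem {r : ℕ} {I : Ideal (MvPolynomial (Fin 2) K)}
    (hI : IsZeroDimIdeal I r) :
    ∃ φ : MvPolynomial (Fin 2) K, φ.IsHomogeneous r ∧ φ ≠ 0 ∧ φ ∈ I := by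
  obtain ⟨l, hl, hreg⟩ := exists_mem_regular I (homogeneousSubmodule (Fin 2) K 1) fun p hp =>
    hI.saturated p fun q hq => by
      refine Submodule.span_induction (p := fun q _ => q * p ∈ I) ?_ (by simp)
        (fun a b _ _ ha hb => by rw [add_mul]; exact I.add_mem ha hb)
        (fun a b _ hb => by rw [smul_eq_mul, mul_assoc]; exact I.mul_mem_left _ hb) hq
      rintro _ ⟨j, rfl⟩
      exact hp _ (isHomogeneous_X K j)
  obtain ⟨N, hN⟩ := hI.degree
  obtain ⟨φ, hφ, hφ0, hmem⟩ := exists_form_map_mem (homogeneousSubmodule (Fin 2) K (N + r))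
    (hN (N + r) (Nat.le_add_right N r)) (LinearMap.mulLeft K (l ^ N)) fun φ hφ => by
      have := (IsHomogeneous.pow hl N).mul hφ
      rwa [one_mul] at this
  refine ⟨φ, hφ, hφ0, ?_⟩
  have hpow : ∀ M, l ^ M * φ ∈ I → φ ∈ I := by
    intro M
    induction M with
    | zero => simp
    | succ M ih => exact fun h => ih (hreg _ (by rwa [← mul_assoc, ← pow_succ']))
  exact hpow N hmem

theorem min_le_gradCactusRank {d k : ℕ} (hk : k < d) {f : MvPolynomial (Fin 2) K}
    (hf : f.IsHomogeneous d) :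
    min (cactusRank d f) ((d - k + 1 : ℕ) : ℕ∞) ≤ gradCactusRank d k f := by
  refine le_iInf₂ fun r ⟨I, hI, hfI⟩ => ?_
  rcases Nat.lt_or_ge (d - k) r with hr | hr
  · exact (min_le_right _ _).trans (by exact_mod_cast hr)
  refine (min_le_left _ _).trans ?_
  obtain ⟨φ, hφ, hφ0, hφI⟩ := hI.exists_form_mem
  refine iInf₂_le_of_le r ⟨Ideal.span {φ}, isZeroDimIdeal_span_singleton hφ hφ0,
    mem_veroneseSpan_iff.mpr ⟨hf, fun P hPI hP => ?_⟩⟩ le_rfl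
  exact apolar_eq_zero_of_nabla hk hr hφ hP (Ideal.mem_span_singleton.mp hPI)
    fun g hg Q hQ hdvd => (mem_veroneseSpan_iff.mp (hfI hg)).2 Q (I.mem_of_dvd hdvd hφI) hQ

end BinaryRanks

/-! ### Polarization and partially symmetric tensors -/

section Polarization

variable {K : Type*} [Field K] {m n : ℕ}

theorem isHomogeneous_of_multiDeg {a : Fin m → ℕ} {Q : MvPolynomial (Fin m × Fin n) K}
    (hQ : IsWeightedHomogeneous (multiDeg m n) Q a) : Q.IsHomogeneous (∑ i, a i) := by
  intro α hα
  have h : ∀ α : Fin m × Fin n →₀ ℕ, ∑ i, Finsupp.weight (multiDeg m n) α i =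
      Finsupp.weight (1 : Fin m × Fin n → ℕ) α := by
    intro α
    induction α using Finsupp.induction_linear with
    | zero => simp
    | add α β hα hβ => simp [Finset.sum_add_distrib, hα, hβ]
    | single p c => simp [Finsupp.weight_single, multiDeg, ← Finset.mul_sum]
  rw [← h, hQ hα]

instance finite_weightedHomogeneousSubmodule_multiDeg (a : Fin m → ℕ) :
    Module.Finite K (weightedHomogeneousSubmodule K (multiDeg m n) a) :=
  Submodule.finiteDimensional_of_le (S₂ := homogeneousSubmodule (Fin m × Fin n) K (∑ i, a i))
    fun _ h => isHomogeneous_of_multiDeg h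

theorem isWeightedHomogeneous_rename {d : ℕ} {P : MvPolynomial (Fin n) K} (hP : P.IsHomogeneous d)
    (i : Fin m) :
    IsWeightedHomogeneous (multiDeg m n) (rename (fun j => (i, j)) P) (Pi.single i d) := by
  refine IsWeightedHomogeneous.induction_on (motive := fun P _ => IsWeightedHomogeneous
    (multiDeg m n) (rename (fun j => (i, j)) P) (Pi.single i d)) ?_ ?_ ?_ hP
  · rw [map_zero]
    exact isWeightedHomogeneous_zero _ _ _
  · intro p q _ _ hp hq
    rw [map_add]
    exact hp.add hq
  · intro α c hα
    rw [rename_monomial]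
    refine isWeightedHomogeneous_monomial _ _ _ ?_
    rw [← hα]
    clear hα
    induction α using Finsupp.induction_linear with
    | zero => simp
    | add α β hα hβ => rw [Finsupp.mapDomain_add, map_add, map_add, hα, hβ, Pi.single_add]
    | single p c =>
      rw [Finsupp.mapDomain_single, Finsupp.weight_single, Finsupp.weight_single, multiDeg,
        ← Pi.single_smul]
      rfl

theorem linForm_isHomogeneous (v : Fin n → K) : (linForm v).IsHomogeneous 1 := by
  simpa [linForm] using isHomogeneous_linear_pow v 1

theorem segreVeronese_isWeightedHomogeneous (e : Fin m → ℕ) (v : Fin m → Fin n → K) :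
    IsWeightedHomogeneous (multiDeg m n) (segreVeronese e v) e := by
  have h := IsWeightedHomogeneous.prod Finset.univ
    (fun i => rename (fun j => (i, j)) (linForm (v i)) ^ e i) _ fun i _ =>
      (isWeightedHomogeneous_rename (linForm_isHomogeneous (v i)) i).pow (e i)
  have he : ∑ i, e i • (Pi.single i 1 : Fin m → ℕ) = e := by
    funext i
    simp [Finset.sum_apply, Pi.single_apply]
  rw [he] at h
  exact h

theorem sum_rename_linForm (v : Fin m → Fin n → K) :
    ∑ i, rename (fun j => (i, j)) (linForm (v i)) =
      (∑ p : Fin m × Fin n, C (v p.1 p.2) * X p : MvPolynomial (Fin m × Fin n) K) := by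
  rw [Fintype.sum_prod_type]
  simp [linForm]

/-- The multidegree `e` term of the multinomial expansion carries the coefficient `(∑ e_i)! / ∏
e_i!`, which the normalization cancels. -/
theorem smul_component_pow [CharZero K] (e : Fin m → ℕ) (v : Fin m → Fin n → K) :
    ((∏ i, ((e i).factorial : K)) / ((∑ i, e i).factorial : K)) •
      weightedHomogeneousComponent (multiDeg m n) e
        ((∑ p : Fin m × Fin n, C (v p.1 p.2) * X p) ^ (∑ i, e i)) = segreVeronese e v := by
  classical
  rw [← sum_rename_linForm, Finset.sum_pow_eq_sum_piAntidiag, map_sum, Finset.sum_eq_single e]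
  · have hs := segreVeronese_isWeightedHomogeneous e v
    rw [← map_natCast (C : K →+* MvPolynomial (Fin m × Fin n) K), weightedHomogeneousComponent_C_mul]
    change _ • (C _ * weightedHomogeneousComponent _ e (segreVeronese e v)) = _
    rw [hs.weightedHomogeneousComponent_same, ← smul_eq_C_mul, smul_smul]
    have h := Nat.multinomial_spec Finset.univ e
    have h' : (∏ i, ((e i).factorial : K)) * (Nat.multinomial Finset.univ e : K) =
        ((∑ i, e i).factorial : K) := by exact_mod_cast h
    rw [div_mul_eq_mul_div, h', div_self (by exact_mod_cast Nat.factorial_ne_zero _), one_smul]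
  · intro a _ hae
    have hs := segreVeronese_isWeightedHomogeneous a v
    rw [← map_natCast (C : K →+* MvPolynomial (Fin m × Fin n) K), weightedHomogeneousComponent_C_mul]
    change C _ * weightedHomogeneousComponent _ e (segreVeronese a v) = 0
    rw [hs.weightedHomogeneousComponent_ne _ hae.symm, mul_zero]
  · intro h
    simp at h

/-- The polarization as a linear map. -/
def polarizationₗ (e : Fin m → ℕ) :
    MvPolynomial (Fin n) K →ₗ[K] MvPolynomial (Fin m × Fin n) K :=
  ((∏ i, ((e i).factorial : K)) / ((∑ i, e i).factorial : K)) •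
    (weightedHomogeneousComponent (multiDeg m n) e ∘ₗ
      (aeval fun j => ∑ i : Fin m, X (i, j)).toLinearMap)

theorem polarizationₗ_apply (e : Fin m → ℕ) (f : MvPolynomial (Fin n) K) :
    polarizationₗ e f = polarization e f := rfl

theorem polarization_isWeightedHomogeneous (e : Fin m → ℕ) (f : MvPolynomial (Fin n) K) :
    IsWeightedHomogeneous (multiDeg m n) (polarization e f) e :=
  (weightedHomogeneousSubmodule K (multiDeg m n) e).smul_mem _
    (weightedHomogeneousComponent_isWeightedHomogeneous _ _)

theorem polarizationₗ_pow [CharZero K] (e : Fin m → ℕ) (v : Fin n → K) :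
    polarizationₗ e (linForm v ^ ∑ i, e i) = segreVeronese e fun _ => v := by
  rw [polarizationₗ_apply, polarization, ← smul_component_pow, map_pow]
  congr 4
  rw [Fintype.sum_prod_type_right]
  simp [linForm, Finset.mul_sum]

theorem apolar_weightedHomogeneousComponent {e : Fin m → ℕ} {Q : MvPolynomial (Fin m × Fin n) K}
    (hQ : IsWeightedHomogeneous (multiDeg m n) Q e) (T : MvPolynomial (Fin m × Fin n) K) :
    apolar Q (weightedHomogeneousComponent (multiDeg m n) e T) = apolar Q T := by
  classical
  refine IsWeightedHomogeneous.induction_on (motive := fun Q _ =>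
    apolar Q (weightedHomogeneousComponent (multiDeg m n) e T) = apolar Q T) ?_ ?_ ?_ hQ
  · simp
  · intro p q _ _ hp hq
    simp [hp, hq]
  · intro α c hα
    rw [apolar_monomial, apolar_monomial, coeff_weightedHomogeneousComponent, if_pos hα]

theorem apolar_segreVeronese [CharZero K] {e : Fin m → ℕ} {Q : MvPolynomial (Fin m × Fin n) K}
    (hQ : IsWeightedHomogeneous (multiDeg m n) Q e) (v : Fin m → Fin n → K) :
    apolar Q (segreVeronese e v) =
      (∏ i, ((e i).factorial : K)) * eval (fun p => v p.1 p.2) Q := by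
  rw [← smul_component_pow, map_smul, apolar_weightedHomogeneousComponent hQ,
    apolar_linear_pow (fun p : Fin m × Fin n => v p.1 p.2) (isHomogeneous_of_multiDeg hQ),
    smul_eq_mul, ← mul_assoc, div_mul_cancel₀ _ (by exact_mod_cast Nat.factorial_ne_zero _)]

theorem eval_rename_snd (v : Fin n → K) (Q : MvPolynomial (Fin m × Fin n) K) :
    eval v (rename Prod.snd Q) = eval (fun p => v p.2) Q := by
  rw [eval_rename]
  rfl

/-- Polarization is adjoint, up to factorials, to restriction to the diagonal. Both sides are
functionals of `f`, hence given by forms, and these are compared through their values, that is, on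
powers. -/
theorem apolar_polarization [CharZero K] {e : Fin m → ℕ} {Q : MvPolynomial (Fin m × Fin n) K}
    (hQ : IsWeightedHomogeneous (multiDeg m n) Q e) {f : MvPolynomial (Fin n) K}
    (hf : f.IsHomogeneous (∑ i, e i)) :
    ((∑ i, e i).factorial : K) * apolar Q (polarization e f) =
      (∏ i, ((e i).factorial : K)) * apolar (rename Prod.snd Q) f := by
  obtain ⟨P, -, hPL, hPe⟩ := exists_apolar_eq (∑ i, e i) (apolar Q ∘ₗ polarizationₗ e)
  have hP : P = (∏ i, ((e i).factorial : K)) • rename Prod.snd Q := by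
    refine MvPolynomial.funext fun v => ?_
    rw [hPe, smul_eval, eval_rename_snd]
    change apolar Q (polarizationₗ e (linForm v ^ ∑ i, e i)) = _
    rw [polarizationₗ_pow, apolar_segreVeronese hQ]
  have := hPL f hf
  rw [hP, map_smul] at this
  exact this.symm

theorem apolar_eq_zero_of_mem_segreVeroneseSpan [CharZero K] {e : Fin m → ℕ}
    {J : Ideal (MvPolynomial (Fin m × Fin n) K)} {Q t : MvPolynomial (Fin m × Fin n) K}
    (hQ : IsWeightedHomogeneous (multiDeg m n) Q e) (hQJ : Q ∈ J)
    (ht : t ∈ segreVeroneseSpan e J) : apolar Q t = 0 := by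
  have he : (∏ i, ((e i).factorial : K)) ≠ 0 :=
    Finset.prod_ne_zero_iff.mpr fun i _ => by exact_mod_cast Nat.factorial_ne_zero _
  have := ht.2 ((∏ i, ((e i).factorial : K))⁻¹ • apolar Q) ⟨Q, hQJ, fun v => ?_⟩
  · exact (smul_eq_zero.mp this).resolve_left (inv_ne_zero he)
  · rw [LinearMap.smul_apply, apolar_segreVeronese hQ, smul_eq_mul, inv_mul_cancel_left₀ he]

/-- A monomial lifts through restriction to the diagonal to any multidegree of the same total: its
variables are distributed arbitrarily among the factors. -/
theorem exists_list_multiDeg (a : Fin m → ℕ) (s : List (Fin n)) (hs : s.length = ∑ i, a i) :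
    ∃ t : List (Fin m × Fin n), t.map Prod.snd = s ∧
      IsWeightedHomogeneous (multiDeg m n)
        (t.map (X : _ → MvPolynomial (Fin m × Fin n) K)).prod a := by
  induction s generalizing a with
  | nil =>
    have ha : a = 0 := by
      ext i
      exact Finset.sum_eq_zero_iff.mp hs.symm i (Finset.mem_univ i)
    exact ⟨[], rfl, by simpa [ha] using isWeightedHomogeneous_one K _⟩
  | cons j s ih =>
    obtain ⟨i, hi⟩ : ∃ i, a i ≠ 0 := by
      by_contra! h
      simp [h] at hs
    have ha : a = Pi.single i 1 + (a - Pi.single i 1) := by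
      ext l
      by_cases hl : l = i
      · subst hl
        simp
        omega
      · simp [hl]
    obtain ⟨t, ht, htw⟩ := ih (a - Pi.single i 1) (by
      rw [ha] at hs
      simp only [Pi.add_apply, Finset.sum_add_distrib, Finset.sum_pi_single', List.length_cons,
        Finset.mem_univ, if_true] at hs
      omega)
    refine ⟨(i, j) :: t, by simp [ht], ?_⟩
    rw [ha, List.map_cons, List.prod_cons]
    exact (isWeightedHomogeneous_X K (multiDeg m n) (i, j)).mul htw

/-- Each derivative of order `k` of `f` is a contraction of the polarization of `f`. -/
theorem exists_monomial_apolar_nabla [CharZero K] {e : Fin (m + 1) → ℕ} {k d : ℕ} (hk : k < d)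
    (hd : ∑ i, e i = d) (he : e (Fin.last m) = d - k) {f g : MvPolynomial (Fin n) K}
    (hf : f.IsHomogeneous d) (hg : g ∈ nabla k f) :
    ∃ M : MvPolynomial (Fin (m + 1) × Fin n) K, ∀ P : MvPolynomial (Fin n) K,
      P.IsHomogeneous (d - k) →
        IsWeightedHomogeneous (multiDeg (m + 1) n)
          (M * rename (fun j => (Fin.last m, j)) P) e ∧
        (∏ i, ((e i).factorial : K)) * apolar P g = (d.factorial : K) *
          apolar (M * rename (fun j => (Fin.last m, j)) P) (polarization e f) := by
  classical
  obtain ⟨s, hs, rfl⟩ := hg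
  have hsum : ∑ i, Function.update e (Fin.last m) 0 i = k := by
    rw [Fin.sum_univ_castSucc] at hd ⊢
    simp only [Function.update_self, Function.update_of_ne (Fin.castSucc_ne_last _), add_zero]
    omega
  obtain ⟨t, ht, htw⟩ := exists_list_multiDeg (K := K) (Function.update e (Fin.last m) 0) s
    (hs.trans hsum.symm)
  refine ⟨(t.map X).prod, fun P hP => ?_⟩
  have hQ : IsWeightedHomogeneous (multiDeg (m + 1) n)
      ((t.map X).prod * rename (fun j => (Fin.last m, j)) P) e := by
    have := htw.mul (isWeightedHomogeneous_rename hP (Fin.last m))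
    convert this using 1
    ext i
    by_cases hi : i = Fin.last m
    · subst hi
      simp [he]
    · simp [hi]
  refine ⟨hQ, ?_⟩
  have h := apolar_polarization hQ (hd ▸ hf)
  rw [hd] at h
  have hQ' : rename Prod.snd ((t.map X).prod * rename (fun j => (Fin.last m, j)) P) =
      (s.map X).prod * P := by
    have h1 : (rename Prod.snd : MvPolynomial (Fin (m + 1) × Fin n) K →ₐ[K] _) ∘ X =
        X ∘ Prod.snd := by
      ext1 p
      simp
    have h2 : rename (Prod.snd ∘ fun j => (Fin.last m, j)) P = P := rename_id_apply P
    rw [map_mul, map_list_prod, rename_rename, h2, ← ht, List.map_map, List.map_map, h1]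
  rw [h, ← apolar_list_mul, hQ']

theorem gradRank_le_partSymRank [CharZero K] {e : Fin (m + 1) → ℕ} {k d : ℕ} (hk : k < d)
    (hd : ∑ i, e i = d) (he : e (Fin.last m) = d - k) {f : MvPolynomial (Fin n) K}
    (hf : f.IsHomogeneous d) : gradRank d k f ≤ partSymRank e (polarization e f) := by
  refine le_iInf₂ fun r ⟨v, hv⟩ => iInf₂_le_of_le r ⟨fun i => v i (Fin.last m), ?_⟩ le_rfl
  intro g hg
  obtain ⟨M, hM⟩ := exists_monomial_apolar_nabla hk hd he hf hg
  have hef : (∏ i, ((e i).factorial : K)) ≠ 0 :=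
    Finset.prod_ne_zero_iff.mpr fun i _ => by exact_mod_cast Nat.factorial_ne_zero _
  have hdk : ((d - k).factorial : K) ≠ 0 := by exact_mod_cast Nat.factorial_ne_zero _
  -- Contracting a rank-one tensor by `M` evaluates `M` at its vectors and leaves a power of the
  -- last one; the factorials come from the normalizations of the pairings.
  refine ⟨fun i => d.factorial / (d - k).factorial * eval (fun p => v i p.1 p.2) M, ?_⟩
  refine eq_of_apolar_eq (nabla_isHomogeneous hf hg) (IsHomogeneous.sum _ _ _ fun i _ =>
    (homogeneousSubmodule (Fin n) K _).smul_mem _ (isHomogeneous_linear_pow _ _)) fun P hP => ?_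
  obtain ⟨hQ, hPg⟩ := hM P hP
  refine mul_left_cancel₀ hef ?_
  rw [hPg, hv, map_sum, map_sum, Finset.mul_sum, Finset.mul_sum]
  refine Finset.sum_congr rfl fun i _ => ?_
  rw [apolar_segreVeronese hQ, map_smul, linForm, apolar_linear_pow _ hP, map_mul, eval_rename,
    smul_eq_mul]
  have : (fun p : Fin (m + 1) × Fin n => v i p.1 p.2) ∘ (fun j => (Fin.last m, j)) =
    v i (Fin.last m) := rfl
  rw [this]
  field_simp

theorem partSymRank_le_waringRank [CharZero K] {e : Fin m → ℕ} {d : ℕ} (hd : ∑ i, e i = d)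
    (f : MvPolynomial (Fin n) K) : partSymRank e (polarization e f) ≤ waringRank d f := by
  refine le_iInf₂ fun r ⟨v, hv⟩ => iInf₂_le_of_le r ⟨fun i _ => v i, ?_⟩ le_rfl
  rw [hv, ← polarizationₗ_apply, map_sum, ← hd]
  exact Finset.sum_congr rfl fun i _ => polarizationₗ_pow e (v i)

end Polarization

/-! ### Zero-dimensional subschemes of products -/

section Product

variable {K : Type*} [Field K] {m n : ℕ}

/-- The dimension count of the one-factor case, with one nonzerodivisor per factor: forms of degree
`r` in the last variables are moved to multidegree `(N, …, N, N + r)`. The resulting `φ` vanishes on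
the projection of the scheme to the last factor. -/
theorem IsMultiZeroDimIdeal.exists_form_mem [CharZero K] {r : ℕ}
    {J : Ideal (MvPolynomial (Fin (m + 1) × Fin 2) K)} (hJ : IsMultiZeroDimIdeal J r) :
    ∃ φ : MvPolynomial (Fin 2) K, φ.IsHomogeneous r ∧ φ ≠ 0 ∧
      rename (fun j => (Fin.last m, j)) φ ∈ J := by
  have hex : ∀ i : Fin (m + 1), ∃ l : MvPolynomial (Fin (m + 1) × Fin 2) K,
      IsWeightedHomogeneous (multiDeg (m + 1) 2) l (Pi.single i 1) ∧
        ∀ p, l * p ∈ J → p ∈ J := by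
    intro i
    refine exists_mem_regular J
      (weightedHomogeneousSubmodule K (multiDeg (m + 1) 2) (Pi.single i 1)) fun p hp =>
        hJ.saturated p fun q hq => ?_
    -- The irrelevant ideal is contained in each factor ideal, so the variables of the `i`-th group
    -- alone test saturation.
    have hq' := Ideal.prod_le_inf hq
    rw [Finset.inf_eq_iInf, Submodule.mem_iInf] at hq'
    have hqi := hq' i
    rw [Submodule.mem_iInf] at hqi
    refine Submodule.span_induction (p := fun q _ => q * p ∈ J) ?_ (by simp)
      (fun a b _ _ ha hb => by rw [add_mul]; exact J.add_mem ha hb)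
      (fun a b _ hb => by rw [smul_eq_mul, mul_assoc]; exact J.mul_mem_left _ hb)
      (hqi (Finset.mem_univ i))
    rintro _ ⟨j, rfl⟩
    exact hp _ (isWeightedHomogeneous_X K _ (i, j))
  choose l hl hreg using hex
  obtain ⟨N, hN⟩ := hJ.degree
  have hh : IsWeightedHomogeneous (multiDeg (m + 1) 2) (∏ i, l i ^ N) fun _ => N := by
    have h := IsWeightedHomogeneous.prod Finset.univ (fun i => l i ^ N) _
      fun i _ => (hl i).pow N
    convert h using 1
    funext i
    simp [Finset.sum_apply, Pi.single_apply]
  obtain ⟨φ, hφ, hφ0, hmem⟩ := exists_form_map_mem (r := r)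
    (weightedHomogeneousSubmodule K (multiDeg (m + 1) 2)
      ((fun _ => N) + (Pi.single (Fin.last m) r : Fin (m + 1) → ℕ)))
    (hN _ fun i => Nat.le_add_right N _)
    (LinearMap.mulLeft K (∏ i, l i ^ N) ∘ₗ (rename fun j => (Fin.last m, j)).toLinearMap)
    fun φ hφ => by
      have h := hh.mul (isWeightedHomogeneous_rename hφ (Fin.last m))
      exact h
  refine ⟨φ, hφ, hφ0, ?_⟩
  have hpow : ∀ i M p, l i ^ M * p ∈ J → p ∈ J := by
    intro i M
    induction M with
    | zero => simp
    | succ M ih => exact fun p h => ih p (hreg i _ (by rwa [← mul_assoc, ← pow_succ']))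
  have hprod : ∀ (s : Finset (Fin (m + 1))) p, (∏ i ∈ s, l i ^ N) * p ∈ J → p ∈ J := by
    intro s
    induction s using Finset.induction_on with
    | empty => simp
    | insert i s hi ih =>
      intro p h
      rw [Finset.prod_insert hi, mul_assoc] at h
      exact ih p (hpow i N _ h)
  exact hprod _ _ hmem

theorem gradCactusRank_le_partSymCactusRank [CharZero K] {e : Fin (m + 1) → ℕ} {k d : ℕ}
    (hk : k < d) (hd : ∑ i, e i = d) (he : e (Fin.last m) = d - k) {f : MvPolynomial (Fin 2) K}
    (hf : f.IsHomogeneous d) :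
    gradCactusRank d k f ≤ partSymCactusRank e (polarization e f) := by
  refine le_iInf₂ fun r ⟨J, hJ, hfJ⟩ => ?_
  obtain ⟨φ, hφ, hφ0, hφJ⟩ := hJ.exists_form_mem
  refine gradCactusRank_le_of_form hf hφ hφ0 ?_
  rintro g hg _ hQ ⟨ψ, rfl⟩
  obtain ⟨M, hM⟩ := exists_monomial_apolar_nabla hk hd he hf hg
  obtain ⟨hwt, hap⟩ := hM _ hQ
  rw [apolar_eq_zero_of_mem_segreVeroneseSpan hwt ?_ hfJ, mul_zero] at hap
  · refine (mul_eq_zero.mp hap).resolve_left ?_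
    exact Finset.prod_ne_zero_iff.mpr fun i _ => by exact_mod_cast Nat.factorial_ne_zero _
  · rw [map_mul]
    exact J.mul_mem_left _ (J.mul_mem_right _ hφJ)

-- The diagonal embedding of a scheme.

attribute [local instance] MvPolynomial.weightedGradedAlgebra

/-- The ideal of the diagonal image in a product of projective spaces of the subscheme with
ideal `I`. -/
def diagonalIdeal (m : ℕ) (I : Ideal (MvPolynomial (Fin n) K)) :
    Ideal (MvPolynomial (Fin m × Fin n) K) :=
  ((I.comap (rename Prod.snd : MvPolynomial (Fin m × Fin n) K →ₐ[K] _)).homogeneousCore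
    (weightedHomogeneousSubmodule K (multiDeg m n))).toIdeal

theorem diagonalIdeal_isHomogeneous (I : Ideal (MvPolynomial (Fin n) K)) :
    (diagonalIdeal m I).IsHomogeneous (weightedHomogeneousSubmodule K (multiDeg m n)) :=
  HomogeneousIdeal.isHomogeneous _

theorem rename_snd_mem_of_mem_diagonalIdeal {I : Ideal (MvPolynomial (Fin n) K)}
    {p : MvPolynomial (Fin m × Fin n) K} (hp : p ∈ diagonalIdeal m I) : rename Prod.snd p ∈ I :=
  Ideal.mem_comap.mp (Ideal.toIdeal_homogeneousCore_le _ _ hp)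

/-- The full preimage contains differences `X (i, j) - X (i', j)`, so it is generally not
multihomogeneous; passing to the core loses no multihomogeneous element. -/
theorem mem_diagonalIdeal_of_isWeightedHomogeneous {I : Ideal (MvPolynomial (Fin n) K)}
    {a : Fin m → ℕ} {p : MvPolynomial (Fin m × Fin n) K}
    (hp : IsWeightedHomogeneous (multiDeg m n) p a) :
    p ∈ diagonalIdeal m I ↔ rename Prod.snd p ∈ I :=
  ⟨rename_snd_mem_of_mem_diagonalIdeal, fun h =>
    Ideal.mem_homogeneousCore_of_homogeneous_of_mem ⟨a, hp⟩ h⟩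

/-- On the diagonal the product of `M` irrelevant ideals becomes an `M`-th power, so saturation has
to be iterated. -/
theorem IsZeroDimIdeal.mem_of_prod_X_mul_mem {r : ℕ} {I : Ideal (MvPolynomial (Fin n) K)}
    (hI : IsZeroDimIdeal I r) (M : ℕ) (g : MvPolynomial (Fin n) K)
    (h : ∀ j : Fin M → Fin n, (∏ i, X (j i)) * g ∈ I) : g ∈ I := by
  induction M generalizing g with
  | zero => simpa using h Fin.elim0
  | succ M ih =>
    refine ih g fun j => hI.saturated _ fun q hq => ?_
    refine Submodule.span_induction (p := fun q _ => q * ((∏ i, X (j i)) * g) ∈ I) ?_ (by simp)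
      (fun a b _ _ ha hb => by rw [add_mul]; exact I.add_mem ha hb)
      (fun a b _ hb => by rw [smul_eq_mul, mul_assoc]; exact I.mul_mem_left _ hb) hq
    rintro _ ⟨l, rfl⟩
    have := h (Fin.cons l j)
    rwa [Fin.prod_univ_succ, Fin.cons_zero, mul_assoc] at this

theorem finrank_map_eq_of_ker_eq {V W₁ W₂ : Type*} [AddCommGroup V] [Module K V] [AddCommGroup W₁]
    [Module K W₁] [AddCommGroup W₂] [Module K W₂] (U : Submodule K V) (g₁ : V →ₗ[K] W₁)
    (g₂ : V →ₗ[K] W₂) (h : ∀ u ∈ U, g₁ u = 0 ↔ g₂ u = 0) :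
    Module.finrank K (U.map g₁) = Module.finrank K (U.map g₂) := by
  have hker : LinearMap.ker (g₁ ∘ₗ U.subtype) = LinearMap.ker (g₂ ∘ₗ U.subtype) := by
    ext u
    exact h u u.2
  have h₁ := (g₁ ∘ₗ U.subtype).quotKerEquivRange.finrank_eq
  have h₂ := (g₂ ∘ₗ U.subtype).quotKerEquivRange.finrank_eq
  rw [LinearMap.range_comp, Submodule.range_subtype] at h₁ h₂
  rw [← h₁, ← h₂, hker]

/-- Restriction to the diagonal is onto because powers of linear forms span and each is the
restriction of a rank-one tensor. So the diagonal scheme in multidegree `a` has the Hilbert function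
of `I` in degree `∑ a_i`. -/
theorem map_rename_snd_weightedHomogeneousSubmodule [CharZero K] (a : Fin m → ℕ) :
    (weightedHomogeneousSubmodule K (multiDeg m n) a).map
      (rename Prod.snd : MvPolynomial (Fin m × Fin n) K →ₐ[K] _).toLinearMap =
        homogeneousSubmodule (Fin n) K (∑ i, a i) := by
  apply le_antisymm
  · rintro _ ⟨Q, hQ, rfl⟩
    exact (isHomogeneous_of_multiDeg hQ).rename_isHomogeneous
  · rw [← span_pow_linForm, Submodule.span_le]
    rintro _ ⟨v, rfl⟩
    refine ⟨_, segreVeronese_isWeightedHomogeneous a fun _ => v, ?_⟩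
    have h : ∀ i : Fin m, rename Prod.snd (rename (fun j => (i, j)) (linForm v)) = linForm v := by
      intro i
      rw [rename_rename]
      exact rename_id_apply _
    simp only [segreVeronese, AlgHom.toLinearMap_apply, map_prod, map_pow, h,
      Finset.prod_pow_eq_pow_sum]

theorem IsZeroDimIdeal.isMultiZeroDimIdeal_diagonalIdeal [CharZero K] {r : ℕ}
    {I : Ideal (MvPolynomial (Fin n) K)} (hI : IsZeroDimIdeal I r) :
    IsMultiZeroDimIdeal (diagonalIdeal (m + 1) I) r where
  homogeneous p hp a :=
    weightedHomogeneousComponent_mem_of_mem K _ (diagonalIdeal_isHomogeneous I) hp a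
  saturated p hp := by
    rw [mem_iff_weightedHomogeneousComponent_mem K _ (diagonalIdeal_isHomogeneous I)]
    intro a
    rw [mem_diagonalIdeal_of_isWeightedHomogeneous
      (weightedHomogeneousComponent_isWeightedHomogeneous a p)]
    refine hI.mem_of_prod_X_mul_mem (m + 1) _ fun j => ?_
    have hq : IsWeightedHomogeneous (multiDeg (m + 1) n)
        (∏ i, X (i, j i) : MvPolynomial (Fin (m + 1) × Fin n) K) _ :=
      IsWeightedHomogeneous.prod Finset.univ _ _ fun i _ => isWeightedHomogeneous_X K _ (i, j i)
    have hqp := hp (∏ i, X (i, j i))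
      (Ideal.prod_mem_prod fun i _ => Ideal.subset_span ⟨j i, rfl⟩)
    have hc := weightedHomogeneousComponent_mem_of_mem K _ (diagonalIdeal_isHomogeneous I) hqp
      (∑ i, multiDeg (m + 1) n (i, j i) + a)
    rw [weightedHomogeneousComponent_mul_left hq] at hc
    have := rename_snd_mem_of_mem_diagonalIdeal hc
    simpa [map_mul, map_prod, rename_X] using this
  degree := by
    obtain ⟨N, hN⟩ := hI.degree
    refine ⟨N, fun a ha => ?_⟩
    rw [← hN (∑ i, a i) ((ha 0).trans (Finset.single_le_sum (fun _ _ => Nat.zero_le _)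
      (Finset.mem_univ (0 : Fin (m + 1)))))]
    rw [hilbertFunction, ← map_rename_snd_weightedHomogeneousSubmodule, ← Submodule.map_comp]
    refine finrank_map_eq_of_ker_eq _ _ _ fun Q hQ => ?_
    have h := mem_diagonalIdeal_of_isWeightedHomogeneous (I := I) hQ
    rw [← Ideal.Quotient.eq_zero_iff_mem, ← Ideal.Quotient.eq_zero_iff_mem] at h
    exact h

theorem partSymCactusRank_le_cactusRank [CharZero K] {e : Fin (m + 1) → ℕ} {d : ℕ}
    (hd : ∑ i, e i = d) (f : MvPolynomial (Fin n) K) :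
    partSymCactusRank e (polarization e f) ≤ cactusRank d f := by
  subst hd
  refine le_iInf₂ fun r ⟨I, hI, hfI⟩ => iInf₂_le_of_le r
    ⟨diagonalIdeal (m + 1) I, hI.isMultiZeroDimIdeal_diagonalIdeal,
      polarization_isWeightedHomogeneous e f, fun L ⟨φ, hφ, hφL⟩ => ?_⟩ le_rfl
  refine hfI.2 (L ∘ₗ polarizationₗ e)
    ⟨rename Prod.snd φ, rename_snd_mem_of_mem_diagonalIdeal hφ, fun v => ?_⟩
  rw [eval_rename_snd, LinearMap.comp_apply, polarizationₗ_pow]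
  exact hφL fun _ => v

end Product

end GradientRank

end

theorem mainTheorem4 {K : Type*} [Field K] [IsAlgClosed K] [CharZero K] (d k : ℕ) (hk : k < d)
    (f : MvPolynomial (Fin 2) K) (hf : f.IsHomogeneous d) :
    GradientRank.gradRank d k f = min (GradientRank.waringRank d f) ((d - k + 1 : ℕ) : ℕ∞) ∧
    GradientRank.gradCactusRank d k f = min (GradientRank.cactusRank d f) ((d - k + 1 : ℕ) : ℕ∞) ∧
    ∀ (m : ℕ) (e : Fin (m + 1) → ℕ), ∑ i, e i = d → e (Fin.last m) = d - k →
      (GradientRank.waringRank d f ≤ ((d - k + 1 : ℕ) : ℕ∞) →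
        GradientRank.waringRank d f =
          GradientRank.partSymRank e (GradientRank.polarization e f) ∧
        GradientRank.partSymRank e (GradientRank.polarization e f) =
          GradientRank.gradRank d k f) ∧
      (GradientRank.cactusRank d f ≤ ((d - k + 1 : ℕ) : ℕ∞) →
        GradientRank.cactusRank d f =
          GradientRank.partSymCactusRank e (GradientRank.polarization e f) ∧
        GradientRank.partSymCactusRank e (GradientRank.polarization e f) =
          GradientRank.gradCactusRank d k f) := by
  have h1 : GradientRank.gradRank d k f =
      min (GradientRank.waringRank d f) ((d - k + 1 : ℕ) : ℕ∞) :=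
    le_antisymm (le_min (GradientRank.gradRank_le_waringRank d k f)
      (GradientRank.gradRank_le_succ hf)) (GradientRank.min_le_gradRank hk hf)
  have h2 : GradientRank.gradCactusRank d k f =
      min (GradientRank.cactusRank d f) ((d - k + 1 : ℕ) : ℕ∞) :=
    le_antisymm (le_min (GradientRank.gradCactusRank_le_cactusRank hk)
      (GradientRank.gradCactusRank_le_succ hf)) (GradientRank.min_le_gradCactusRank hk hf)
  refine ⟨h1, h2, fun m e hd he => ⟨fun h => ?_, fun h => ?_⟩⟩
  -- The gradient rank now equals the Waring rank, and the partially symmetric rank is squeezed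
  -- between them.
  · rw [min_eq_left h] at h1
    have hle := GradientRank.gradRank_le_partSymRank hk hd he hf
    have hge := GradientRank.partSymRank_le_waringRank hd f
    exact ⟨le_antisymm (h1 ▸ hle) hge, le_antisymm (h1 ▸ hge) hle⟩
  · rw [min_eq_left h] at h2
    have hle := GradientRank.gradCactusRank_le_partSymCactusRank hk hd he hf
    have hge := GradientRank.partSymCactusRank_le_cactusRank hd f
    exact ⟨le_antisymm (h2 ▸ hle) hge, le_antisymm (h2 ▸ hge) hle⟩
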